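/- Let $X$ be a Polish space (a separable topological space that can be metrized by a complete distance), let $\mathcal M_+^1(X)$ be the set of Borel probability measures on $X$, and let $p\ge 1$ be a real number. Let $d:X\times X\to[0,\infty)$ be a distance on $X$, that is, $d(x,y)=d(y,x)\ge 0$, $d(x,y)=0$ if and only if $x=y$, and $d(x,z)\le d(x,y)+d(y,z)$ for all $x,y,z\in X$. Assume that $d$ is lower semicontinuous on $X\times X$ (this holds in particular if $d$ induces the topology of $X$, and for the $0/1$ distance). For $\alpha,\beta\in\mathcal M_+^1(X)$ let $\mathcal U(\alpha,\beta)$ be the set of probability measures $\pi$ on $X\times X$ whose first and second marginals are $\alpha$ and $\beta$, and put $$\mathrm{MK}_{d^p}(\alpha,\beta)=\inf_{\pi\in\mathcal U(\alpha,\beta)}\int_{X\times X} d(x,y)^p\,\mathrm d\pi(x,y)\in[0,\infty],\qquad W_p(\alpha,\beta)=\mathrm{MK}_{d^p}(\alpha,\beta)^{1/p}\in[0,\infty].$$ Then the infimum is attained, i.e. it is a minimum, and $W_p$ is a distance on probability measures: for all $\alpha,\beta,\gamma\in\mathcal M_+^1(X)$, 1. $W_p(\alpha,\beta)=W_p(\beta,\alpha)$;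 2. $W_p(\alpha,\beta)=0$ if and only if $\alpha=\beta$; 3. $W_p(\alpha,\gamma)\le W_p(\alpha,\beta)+W_p(\beta,\gamma)$; 4. $W_p(\alpha,\beta)<\infty$ whenever $\alpha$ and $\beta$ have a finite moment of order $p$, i.e. whenever $\int_X d(x_0,x)^p\,\mathrm d\alpha(x)<\infty$ for some $x_0\in X$ and $\int_X d(y_0,x)^p\,\mathrm d\beta(x)<\infty$ for some $y_0\in X$. In particular $W_p$ is a finite distance on the set of probability measures with finite moment of order $p$, which is all of $\mathcal M_+^1(X)$ if $d$ is bounded. -/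

import Mathlib

open MeasureTheory
open scoped ENNReal

namespace OptimalTransport

/-- A distance on a set `X`, as a real-valued function of two variables. It is kept separate from
the topology of `X`, which need not be the one that the distance induces. -/
structure IsDistance {X : Type*} (d : X → X → ℝ) : Prop where
  symm : ∀ x y, d x y = d y x
  nonneg : ∀ x y, 0 ≤ d x y
  eq_zero_iff : ∀ x y, d x y = 0 ↔ x = y
  triangle : ∀ x y z, d x z ≤ d x y + d y z

/-- The couplings of `α` and `β`: the probability measures on `X × Y` with marginals `α`, `β`. -/
def couplings {X Y : Type*} [MeasurableSpace X] [MeasurableSpace Y]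
    (α : ProbabilityMeasure X) (β : ProbabilityMeasure Y) : Set (ProbabilityMeasure (X × Y)) :=
  {π | (π : Measure (X × Y)).map Prod.fst = (α : Measure X) ∧
    (π : Measure (X × Y)).map Prod.snd = (β : Measure Y)}

/-- The total cost `∫ c(x, y) dπ(x, y)` of a coupling, for a nonnegative cost. -/
noncomputable def transportCost {X Y : Type*} [MeasurableSpace X] [MeasurableSpace Y]
    (c : X → Y → ℝ≥0∞) (π : ProbabilityMeasure (X × Y)) : ℝ≥0∞ :=
  ∫⁻ z, c z.1 z.2 ∂(π : Measure (X × Y))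

/-- The Monge–Kantorovich value: the least cost of a coupling of `α` and `β`. -/
noncomputable def MK {X Y : Type*} [MeasurableSpace X] [MeasurableSpace Y]
    (c : X → Y → ℝ≥0∞) (α : ProbabilityMeasure X) (β : ProbabilityMeasure Y) : ℝ≥0∞ :=
  ⨅ π ∈ couplings α β, transportCost c π

/-- The cost `d(x, y) ^ p`. -/
noncomputable def distPow {X : Type*} (d : X → X → ℝ) (p : ℝ) (x y : X) : ℝ≥0∞ :=
  ENNReal.ofReal (d x y ^ p)

/-- The `p`-Wasserstein distance `MK_{d^p}(α, β)^{1/p}`, with values in `[0, ∞]`. -/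
noncomputable def wasserstein {X : Type*} [MeasurableSpace X] (d : X → X → ℝ) (p : ℝ)
    (α β : ProbabilityMeasure X) : ℝ≥0∞ :=
  MK (distPow d p) α β ^ (1 / p)

/-- `α` has a finite moment of order `p` for `d`. -/
def HasFiniteMoment {X : Type*} [MeasurableSpace X] (d : X → X → ℝ) (p : ℝ)
    (α : ProbabilityMeasure X) : Prop :=
  ∃ x₀ : X, ∫⁻ x, distPow d p x₀ x ∂(α : Measure X) < ∞

end OptimalTransport

/-! Couplings of two laws on Polish spaces form a weakly compact set, and the cost is weakly lower
semicontinuous, so the direct method yields an optimal coupling. Definiteness follows: an optimal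
coupling of zero cost lives on the diagonal. For the triangle inequality, optimal couplings of `α,
β` and `β, γ` are glued along `β` (`exists_gluing`). The outer marginal of the result couples `α`
and `γ`, and Minkowski in `L^p` bounds its cost. Finiteness is the triangle inequality along a path
through two point masses. -/

namespace OptimalTransport

open Filter Topology ProbabilityTheory

section Coupling

variable {X Y Z : Type*} [MeasurableSpace X] [MeasurableSpace Y] [MeasurableSpace Z]

/-- The product measure is a coupling. -/
theorem prod_mem_couplings (α : ProbabilityMeasure X) (β : ProbabilityMeasure Y) :
    α.prod β ∈ couplings α β := by
  constructor <;> simp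

/-- Exchanging the two variables turns couplings of `α, β` into couplings of `β, α`. -/
theorem map_swap_mem_couplings {α : ProbabilityMeasure X} {β : ProbabilityMeasure Y}
    {π : ProbabilityMeasure (X × Y)} (hπ : π ∈ couplings α β) :
    π.map measurable_swap.aemeasurable ∈ couplings β α := by
  constructor
  · rw [ProbabilityMeasure.toMeasure_map, Measure.map_map measurable_fst measurable_swap]
    exact hπ.2
  · rw [ProbabilityMeasure.toMeasure_map, Measure.map_map measurable_snd measurable_swap]
    exact hπ.1

/-- The image of `α` on the diagonal is a coupling of `α` with itself. -/
theorem map_diag_mem_couplings (α : ProbabilityMeasure X) :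
    α.map (measurable_id.prodMk measurable_id).aemeasurable ∈ couplings α α := by
  constructor
  · rw [ProbabilityMeasure.toMeasure_map,
      Measure.map_map measurable_fst (measurable_id.prodMk measurable_id)]
    exact Measure.map_id
  · rw [ProbabilityMeasure.toMeasure_map,
      Measure.map_map measurable_snd (measurable_id.prodMk measurable_id)]
    exact Measure.map_id

theorem MK_le_transportCost (c : X → Y → ℝ≥0∞) {α : ProbabilityMeasure X}
    {β : ProbabilityMeasure Y} {π : ProbabilityMeasure (X × Y)} (hπ : π ∈ couplings α β) :
    MK c α β ≤ transportCost c π :=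
  iInf₂_le π hπ

/-- **Gluing lemma**: couplings of `α, β` and of `β, γ` are the two marginals of a common
probability measure on the triple product. -/
theorem exists_gluing [StandardBorelSpace Z] [Nonempty Z] {α : ProbabilityMeasure X}
    {β : ProbabilityMeasure Y} {γ : ProbabilityMeasure Z} {π : ProbabilityMeasure (X × Y)}
    {ρ : ProbabilityMeasure (Y × Z)} (hπ : π ∈ couplings α β) (hρ : ρ ∈ couplings β γ) :
    ∃ σ : ProbabilityMeasure ((X × Y) × Z),
      (σ : Measure ((X × Y) × Z)).map Prod.fst = π ∧
      (σ : Measure ((X × Y) × Z)).map (fun z => (z.1.2, z.2)) = ρ := by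
  -- `κ` is the law of `z` given `y` under `ρ`. Drawing `z` from it makes `z` independent of `x`
  -- given `y`.
  set κ := (ρ : Measure (Y × Z)).condKernel
  refine ⟨⟨(π : Measure (X × Y)) ⊗ₘ κ.comap Prod.snd measurable_snd, inferInstance⟩, ?_, ?_⟩
  · exact Measure.fst_compProd _ _
  · have hκ : (β : Measure Y) ⊗ₘ κ = ρ := by
      rw [← hρ.1]
      exact (ρ : Measure (Y × Z)).disintegrate κ
    refine Eq.trans ?_ hκ
    ext s hs
    have hm : Measurable fun z : (X × Y) × Z => (z.1.2, z.2) := by fun_prop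
    -- The mass of a section depends on `y` only, so integrating over `π` amounts to integrating
    -- over `β`.
    rw [Measure.map_apply hm hs, Measure.compProd_apply hs, ← hπ.2,
      lintegral_map (Kernel.measurable_kernel_prodMk_left hs) measurable_snd]
    exact Measure.compProd_apply (hm hs)

/-- Exchanging the two variables does not change the value for a symmetric cost. -/
theorem MK_comm {c : X → X → ℝ≥0∞} (hc : ∀ x y, c x y = c y x)
    (hm : Measurable fun z : X × X => c z.1 z.2) (α β : ProbabilityMeasure X) :
    MK c α β = MK c β α := by
  have key (α β : ProbabilityMeasure X) : MK c α β ≤ MK c β α := by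
    refine le_iInf₂ fun π hπ => (MK_le_transportCost c (map_swap_mem_couplings hπ)).trans_eq ?_
    rw [transportCost, ProbabilityMeasure.toMeasure_map, lintegral_map hm measurable_swap]
    exact lintegral_congr fun z => hc _ _
  exact le_antisymm (key α β) (key β α)

end Coupling

section Existence

/-- Lower semicontinuity of `μ ↦ ∫ f dμ` along sequences, for `f` nonnegative and lower
semicontinuous. -/
theorem lintegral_le_liminf_of_lowerSemicontinuous {Ω : Type*} [TopologicalSpace Ω]
    [MeasurableSpace Ω] [OpensMeasurableSpace Ω] [HasOuterApproxClosed Ω] {f : Ω → ℝ}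
    (hf : LowerSemicontinuous f) (hf₀ : 0 ≤ f) {μ : ProbabilityMeasure Ω}
    {μs : ℕ → ProbabilityMeasure Ω} (hμ : Tendsto μs atTop (𝓝 μ)) :
    ∫⁻ x, ENNReal.ofReal (f x) ∂(μ : Measure Ω) ≤
      liminf (fun n => ∫⁻ x, ENNReal.ofReal (f x) ∂(μs n : Measure Ω)) atTop := by
  -- Layer cake: the superlevel sets are open, so the portmanteau theorem applies to each, and Fatou
  -- in `t` concludes.
  simp_rw [lintegral_eq_lintegral_meas_lt _ (Eventually.of_forall hf₀) hf.measurable.aemeasurable]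
  calc ∫⁻ t in Set.Ioi 0, (μ : Measure Ω) {a | t < f a}
      ≤ ∫⁻ t in Set.Ioi 0, liminf (fun n => (μs n : Measure Ω) {a | t < f a}) atTop :=
        lintegral_mono fun t => ProbabilityMeasure.le_liminf_measure_open_of_tendsto hμ
          (hf.isOpen_preimage t)
    _ ≤ _ := lintegral_liminf_le fun n => Antitone.measurable fun s t hst =>
        measure_mono fun _ ha => lt_of_le_of_lt hst ha

variable {X Y : Type*} [TopologicalSpace X] [PolishSpace X] [MeasurableSpace X] [BorelSpace X]
  [TopologicalSpace Y] [PolishSpace Y] [MeasurableSpace Y] [BorelSpace Y]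

/-- The couplings of two probability measures on Polish spaces form a compact set. -/
theorem isCompact_couplings (α : ProbabilityMeasure X) (β : ProbabilityMeasure Y) :
    IsCompact (couplings α β) := by
  have hclosed : IsClosed (couplings α β) := by
    have h : couplings α β = {π : ProbabilityMeasure (X × Y) |
        π.map measurable_fst.aemeasurable = α ∧ π.map measurable_snd.aemeasurable = β} := by
      ext π
      change _ ↔ _ ∧ _
      rw [← ProbabilityMeasure.toMeasure_injective.eq_iff,
        ← ProbabilityMeasure.toMeasure_injective.eq_iff, ProbabilityMeasure.toMeasure_map,
        ProbabilityMeasure.toMeasure_map]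
      rfl
    rw [h]
    exact (isClosed_eq (ProbabilityMeasure.continuous_map continuous_fst) continuous_const).inter
      (isClosed_eq (ProbabilityMeasure.continuous_map continuous_snd) continuous_const)
  rw [← hclosed.closure_eq]
  -- Prokhorov's theorem. Tightness passes from the marginals, which are single measures and hence
  -- tight on a Polish space.
  apply isCompact_closure_of_isTightMeasureSet
  apply IsTightMeasureSet.prodMk
  · refine (isTightMeasureSet_singleton (μ := (α : Measure X))).subset ?_
    rintro _ ⟨_, ⟨π, hπ, rfl⟩, rfl⟩
    exact hπ.1
  · refine (isTightMeasureSet_singleton (μ := (β : Measure Y))).subset ?_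
    rintro _ ⟨_, ⟨π, hπ, rfl⟩, rfl⟩
    exact hπ.2

/-- Optimal couplings exist for nonnegative lower semicontinuous costs. -/
theorem exists_transportCost_eq_MK {c : X → Y → ℝ}
    (hc : LowerSemicontinuous fun z : X × Y => c z.1 z.2) (hc₀ : ∀ x y, 0 ≤ c x y)
    (α : ProbabilityMeasure X) (β : ProbabilityMeasure Y) :
    ∃ π ∈ couplings α β, transportCost (fun x y => ENNReal.ofReal (c x y)) π =
      MK (fun x y => ENNReal.ofReal (c x y)) α β := by
  set C : ProbabilityMeasure (X × Y) → ℝ≥0∞ := transportCost fun x y => ENNReal.ofReal (c x y)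
    with hC
  obtain ⟨u, -, hu, hmem⟩ := exists_seq_tendsto_sInf
    (Set.Nonempty.image C ⟨_, prod_mem_couplings α β⟩) (OrderBot.bddBelow _)
  choose πs hπs hπu using hmem
  obtain ⟨π, hπ, φ, hφ, hlim⟩ := (isCompact_couplings α β).tendsto_subseq hπs
  refine ⟨π, hπ, le_antisymm ?_ (MK_le_transportCost _ hπ)⟩
  have h := lintegral_le_liminf_of_lowerSemicontinuous hc (fun z => hc₀ _ _) hlim
  refine h.trans_eq ?_
  -- Along the subsequence the costs still converge to the infimum, so their liminf is `MK`.
  have hu' : Tendsto (fun n => C (πs (φ n))) atTop (𝓝 (sInf (C '' couplings α β))) := by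
    simpa only [hπu, Function.comp_def] using hu.comp hφ.tendsto_atTop
  rw [sInf_image] at hu'
  exact hu'.liminf_eq

end Existence

section Distance

theorem distPow_eq_rpow {X : Type*} {d : X → X → ℝ} (hd : IsDistance d) {p : ℝ} (hp : 0 ≤ p)
    (x y : X) : distPow d p x y = ENNReal.ofReal (d x y) ^ p :=
  (ENNReal.ofReal_rpow_of_nonneg (hd.nonneg x y) hp).symm

/-- Composing with a continuous monotone map preserves lower semicontinuity. Truncating at `0` makes
the power monotone on all of `ℝ`. -/
theorem lowerSemicontinuous_rpow_of_nonneg {Ω : Type*} [TopologicalSpace Ω] {f : Ω → ℝ}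
    (hf : LowerSemicontinuous f) (hf₀ : ∀ x, 0 ≤ f x) {p : ℝ} (hp : 0 ≤ p) :
    LowerSemicontinuous fun x => f x ^ p := by
  have hg : Monotone fun t : ℝ => max t 0 ^ p := fun s t hst =>
    Real.rpow_le_rpow (le_max_right _ _) (max_le_max_right 0 hst) hp
  have hc : Continuous fun t : ℝ => max t 0 ^ p :=
    (continuous_id.max continuous_const).rpow_const fun _ => Or.inr hp
  simpa only [Function.comp_def, max_eq_left (hf₀ _)] using hc.comp_lowerSemicontinuous hf hg

variable {X : Type*} [MeasurableSpace X] {d : X → X → ℝ} {p : ℝ}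

theorem measurable_distPow (p : ℝ) (hm : Measurable fun z : X × X => d z.1 z.2) :
    Measurable fun z : X × X => distPow d p z.1 z.2 :=
  (hm.pow_const p).ennreal_ofReal

/-- Minkowski's inequality for the two successive legs of a glued coupling. -/
theorem wasserstein_le_add_of_couplings [StandardBorelSpace X] (hd : IsDistance d)
    (hm : Measurable fun z : X × X => d z.1 z.2) (hp : 1 ≤ p) {α β γ : ProbabilityMeasure X}
    {π ρ : ProbabilityMeasure (X × X)} (hπ : π ∈ couplings α β) (hρ : ρ ∈ couplings β γ) :
    wasserstein d p α γ ≤ transportCost (distPow d p) π ^ (1 / p) +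
      transportCost (distPow d p) ρ ^ (1 / p) := by
  have hp₀ : 0 ≤ p := zero_le_one.trans hp
  have : Nonempty X := α.nonempty
  obtain ⟨σ, hσ₁, hσ₂⟩ := exists_gluing hπ hρ
  have hm₁₃ : Measurable fun z : (X × X) × X => (z.1.1, z.2) := by fun_prop
  have hm₂₃ : Measurable fun z : (X × X) × X => (z.1.2, z.2) := by fun_prop
  have hcost := measurable_distPow p hm
  set τ : ProbabilityMeasure (X × X) := σ.map hm₁₃.aemeasurable
  have hτ : τ ∈ couplings α γ := by
    constructor
    · rw [ProbabilityMeasure.toMeasure_map, Measure.map_map measurable_fst hm₁₃, ← hπ.1, ← hσ₁,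
        Measure.map_map measurable_fst measurable_fst]
      rfl
    · rw [ProbabilityMeasure.toMeasure_map, Measure.map_map measurable_snd hm₁₃, ← hρ.2, ← hσ₂,
        Measure.map_map measurable_snd hm₂₃]
      rfl
  have hmo : Measurable fun z : X × X => ENNReal.ofReal (d z.1 z.2) := hm.ennreal_ofReal
  calc wasserstein d p α γ
      ≤ transportCost (distPow d p) τ ^ (1 / p) := by
        unfold wasserstein
        gcongr
        exact MK_le_transportCost _ hτ
    _ = (∫⁻ z, ENNReal.ofReal (d z.1.1 z.2) ^ p ∂(σ : Measure ((X × X) × X))) ^ (1 / p) := by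
        rw [transportCost, ProbabilityMeasure.toMeasure_map, lintegral_map hcost hm₁₃]
        simp only [distPow_eq_rpow hd hp₀]
    _ ≤ (∫⁻ z, ((fun z : (X × X) × X => ENNReal.ofReal (d z.1.1 z.1.2)) +
          fun z : (X × X) × X => ENNReal.ofReal (d z.1.2 z.2)) z ^ p
            ∂(σ : Measure ((X × X) × X))) ^ (1 / p) := by
        gcongr with z
        rw [Pi.add_apply, ← ENNReal.ofReal_add (hd.nonneg _ _) (hd.nonneg _ _)]
        exact ENNReal.ofReal_le_ofReal (hd.triangle _ _ _)
    _ ≤ (∫⁻ z, ENNReal.ofReal (d z.1.1 z.1.2) ^ p ∂(σ : Measure ((X × X) × X))) ^ (1 / p) +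
        (∫⁻ z, ENNReal.ofReal (d z.1.2 z.2) ^ p ∂(σ : Measure ((X × X) × X))) ^ (1 / p) :=
        ENNReal.lintegral_Lp_add_le (hmo.comp measurable_fst).aemeasurable
          (hmo.comp hm₂₃).aemeasurable hp
    _ = _ := by
        rw [transportCost, transportCost, ← hσ₁, ← hσ₂, lintegral_map hcost measurable_fst,
          lintegral_map hcost hm₂₃]
        simp only [distPow_eq_rpow hd hp₀]

/-- A measure with a finite moment is at finite distance from some point mass. -/
theorem HasFiniteMoment.exists_wasserstein_dirac_lt_top
    (hm : Measurable fun z : X × X => d z.1 z.2) (hp : 0 < p) {α : ProbabilityMeasure X}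
    (hα : HasFiniteMoment d p α) :
    ∃ x₀ : X, wasserstein d p (diracProba x₀) α < ∞ := by
  obtain ⟨x₀, hx₀⟩ := hα
  refine ⟨x₀, ENNReal.rpow_lt_top_of_nonneg (by positivity) (ne_of_lt ?_)⟩
  have hcost := measurable_distPow p hm
  refine (MK_le_transportCost _ (prod_mem_couplings _ α)).trans_lt ?_
  rw [transportCost, ProbabilityMeasure.toMeasure_prod]
  rwa [show (diracProba x₀ : Measure X) = Measure.dirac x₀ from rfl, Measure.dirac_prod,
    lintegral_map hcost measurable_prodMk_left]

/-- Links the base points of the two moment conditions, which may differ. -/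
theorem wasserstein_dirac_dirac_lt_top (hm : Measurable fun z : X × X => d z.1 z.2) (hp : 0 < p)
    (x y : X) :
    wasserstein d p (diracProba x) (diracProba y) < ∞ := by
  refine ENNReal.rpow_lt_top_of_nonneg (by positivity) (ne_of_lt ?_)
  have hcost := measurable_distPow p hm
  refine (MK_le_transportCost _ (prod_mem_couplings _ _)).trans_lt ?_
  rw [transportCost, ProbabilityMeasure.toMeasure_prod]
  rw [show (diracProba x : Measure X) = Measure.dirac x from rfl,
    show (diracProba y : Measure X) = Measure.dirac y from rfl, Measure.dirac_prod_dirac,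
    lintegral_dirac' _ hcost]
  exact ENNReal.ofReal_lt_top

theorem wasserstein_self (hd : IsDistance d) (hm : Measurable fun z : X × X => d z.1 z.2)
    (hp : 0 < p) (α : ProbabilityMeasure X) : wasserstein d p α α = 0 := by
  have hcost := measurable_distPow p hm
  have h : MK (distPow d p) α α = 0 := by
    refine le_antisymm ((MK_le_transportCost _ (map_diag_mem_couplings α)).trans_eq ?_) zero_le
    rw [transportCost, ProbabilityMeasure.toMeasure_map,
      lintegral_map hcost (measurable_id.prodMk measurable_id)]
    simp [distPow, (hd.eq_zero_iff _ _).2 rfl, Real.zero_rpow hp.ne']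
  rw [wasserstein, h, ENNReal.zero_rpow_of_pos (by positivity)]

/-- A coupling of zero cost is concentrated on the diagonal, so its marginals agree. -/
theorem eq_of_transportCost_eq_zero (hd : IsDistance d)
    (hm : Measurable fun z : X × X => d z.1 z.2) (hp : 0 < p) {α β : ProbabilityMeasure X}
    {π : ProbabilityMeasure (X × X)} (hπ : π ∈ couplings α β)
    (h : transportCost (distPow d p) π = 0) : α = β := by
  have hcost := measurable_distPow p hm
  rw [transportCost, lintegral_eq_zero_iff hcost] at h
  have hdiag : Prod.fst =ᵐ[(π : Measure (X × X))] Prod.snd := by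
    filter_upwards [h] with z hz
    rw [Pi.zero_apply, distPow_eq_rpow hd hp.le, ENNReal.rpow_eq_zero_iff_of_pos hp,
      ENNReal.ofReal_eq_zero] at hz
    exact (hd.eq_zero_iff _ _).1 (hz.antisymm (hd.nonneg _ _))
  apply Subtype.ext
  exact hπ.1.symm.trans ((Measure.map_congr hdiag).trans hπ.2)

end Distance

end OptimalTransport

theorem mainTheorem4 {X : Type*} [TopologicalSpace X] [PolishSpace X] [MeasurableSpace X]
    [BorelSpace X] (d : X → X → ℝ) (hd : OptimalTransport.IsDistance d)
    (hlsc : LowerSemicontinuous (fun z : X × X => d z.1 z.2)) (p : ℝ) (hp : 1 ≤ p) :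
    -- the minimum that defines `MK` is attained
    (∀ α β : ProbabilityMeasure X, ∃ π ∈ OptimalTransport.couplings α β,
      OptimalTransport.transportCost (OptimalTransport.distPow d p) π =
        OptimalTransport.MK (OptimalTransport.distPow d p) α β) ∧
    -- symmetry
    (∀ α β : ProbabilityMeasure X,
      OptimalTransport.wasserstein d p α β = OptimalTransport.wasserstein d p β α) ∧
    -- definiteness
    (∀ α β : ProbabilityMeasure X, OptimalTransport.wasserstein d p α β = 0 ↔ α = β) ∧
    -- triangle inequality
    (∀ α β γ : ProbabilityMeasure X,
      OptimalTransport.wasserstein d p α γ ≤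
        OptimalTransport.wasserstein d p α β + OptimalTransport.wasserstein d p β γ) ∧
    -- finiteness on the measures with a finite moment of order `p`
    (∀ α β : ProbabilityMeasure X, OptimalTransport.HasFiniteMoment d p α →
      OptimalTransport.HasFiniteMoment d p β → OptimalTransport.wasserstein d p α β < ∞) := by
  open OptimalTransport in
  have hp₀ : 0 < p := zero_lt_one.trans_le hp
  have hm : Measurable fun z : X × X => d z.1 z.2 := hlsc.measurable
  have hcost := measurable_distPow p hm
  have hmin (α β : ProbabilityMeasure X) : ∃ π ∈ couplings α β,
      transportCost (distPow d p) π = MK (distPow d p) α β :=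
    exists_transportCost_eq_MK (lowerSemicontinuous_rpow_of_nonneg hlsc
      (fun z => hd.nonneg z.1 z.2) hp₀.le) (fun x y => Real.rpow_nonneg (hd.nonneg x y) p) α β
  have hsymm (α β : ProbabilityMeasure X) : wasserstein d p α β = wasserstein d p β α := by
    rw [wasserstein, wasserstein, MK_comm (fun x y => by rw [distPow, distPow, hd.symm]) hcost]
  have htri (α β γ : ProbabilityMeasure X) :
      wasserstein d p α γ ≤ wasserstein d p α β + wasserstein d p β γ := by
    obtain ⟨π, hπ, hπc⟩ := hmin α β
    obtain ⟨ρ, hρ, hρc⟩ := hmin β γ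
    have h := wasserstein_le_add_of_couplings hd hm hp hπ hρ
    rwa [hπc, hρc] at h
  refine ⟨hmin, hsymm, fun α β => ⟨fun h => ?_, ?_⟩, htri, fun α β hα hβ => ?_⟩
  · obtain ⟨π, hπ, hπc⟩ := hmin α β
    rw [wasserstein, ENNReal.rpow_eq_zero_iff_of_pos (by positivity)] at h
    exact eq_of_transportCost_eq_zero hd hm hp₀ hπ (hπc.trans h)
  · rintro rfl
    exact wasserstein_self hd hm hp₀ α
  · obtain ⟨x, hx⟩ := hα.exists_wasserstein_dirac_lt_top hm hp₀
    obtain ⟨y, hy⟩ := hβ.exists_wasserstein_dirac_lt_top hm hp₀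
    rw [hsymm] at hx
    -- The path is `α`, `δ_x`, `δ_y`, `β`.
    exact (htri α _ β).trans_lt (ENNReal.add_lt_top.2 ⟨hx, (htri _ _ β).trans_lt
      (ENNReal.add_lt_top.2 ⟨wasserstein_dirac_dirac_lt_top hm hp₀ x y, hy⟩)⟩)
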